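/- Let $\mathbb T=\mathbb R/\mathbb Z$ be the unit torus with normalized Lebesgue measure $dk$, let $\gamma_0,\gamma_1>0$, and let $(\alpha_x)_{x\in\mathbb Z}$ be real numbers such that - there is $C>0$ with $|\alpha_x|\le Ce^{-|x|/C}$ for all $x\in\mathbb Z$; - the Fourier series $\hat\alpha(k)=\sum_{x\in\mathbb Z}\alpha_xe^{-2\pi ixk}$ is real valued, $\hat\alpha(k)>0$ for $k\ne0$, and $\hat\alpha''(0)>0$ in case $\hat\alpha(0)=0$; - the dispersion relation $\omega(k):=\sqrt{\hat\alpha(k)}$ is strictly increasing on $[0,1/2]$. Put $R(k)=\sin^2(2\pi k)+2\sin^2(\pi k)$, $\mathfrak f=(1,-1)^T$ and, for $\epsilon>0$, $$ \Omega_\epsilon(k)=\begin{pmatrix}-\gamma_0\epsilon R(k)-i\omega(k)&\gamma_0\epsilon R(k)\\ \gamma_0\epsilon R(k)&-\gamma_0\epsilon R(k)+i\omega(k)\end{pmatrix}, $$ $$ J(t)=\int_{\mathbb T}\cos(\omega(k)t)\,dk,\qquad J_\epsilon(t)=\frac12\int_{\mathbb T}\big(e^{\Omega_\epsilon(k)t}\,\mathfrak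 f\big)\cdot\mathfrak f\,dk . $$ Denote by $\tilde f(\lambda)=\int_0^\infty e^{-\lambda t}f(t)\,dt$ the Laplace transform and, for $\lambda\in\mathbb C_+=\{\lambda:\operatorname{Re}\lambda>0\}$, set $\tilde g(\lambda)=(1+\gamma_1\tilde J(\lambda))^{-1}$ and $\tilde g_\epsilon(\lambda)=(1+\gamma_1\tilde J_\epsilon(\lambda))^{-1}$. Define $\tilde r_\epsilon$ by $$ \tilde g_\epsilon(\lambda)=\tilde g(\lambda)+\epsilon\,\tilde r_\epsilon(\lambda),\qquad \lambda\in\mathbb C_+ . $$ Suppose that $K:\mathbb T\to(0,\infty)$ is a uniformly continuous and bounded function with $\inf_{k\in\mathbb T}K(k)>0$. Then, for every $p\in[1,\infty)$, the function $k\mapsto|\tilde r_\epsilon(\epsilon K(k)-i\omega(k))|^p$ is integrable on $\mathbb T$ for each $\epsilon>0$, and $$ \lim_{\epsilon\to0+}\epsilon^p\int_{\mathbb T}\big|\tilde r_\epsilon(\epsilon K(k)-i\omega(k))\big|^p\,dk=0 . $$ -/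

import Mathlib

open MeasureTheory Filter Topology

noncomputable section

namespace HarmonicChain

/-- The unit torus `ℝ / ℤ`; its `volume` is the Haar measure of total mass one. -/
abbrev Torus : Type := UnitAddCircle

/-- The Fourier series `∑ x, α_x exp(-2πi x k)` of a real sequence. -/
def fourierSeries (α : ℤ → ℝ) (k : Torus) : ℂ :=
  ∑' x : ℤ, (α x : ℂ) * fourier (-x) k

/-- The dispersion relation `ω = √α̂`. -/
def dispersion (α : ℤ → ℝ) (k : Torus) : ℝ :=
  Real.sqrt (fourierSeries α k).re

/-- The standing assumptions on the coupling constants. -/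
structure IsAdmissibleCoupling (α : ℤ → ℝ) : Prop where
  exp_decay : ∃ C : ℝ, 0 < C ∧ ∀ x : ℤ, |α x| ≤ C * Real.exp (-|(x : ℝ)| / C)
  real_valued : ∀ k : Torus, (fourierSeries α k).im = 0
  pos : ∀ k : Torus, k ≠ 0 → 0 < (fourierSeries α k).re
  second_deriv_pos : fourierSeries α 0 = 0 →
    0 < iteratedDeriv 2 (fun s : ℝ => (fourierSeries α (s : Torus)).re) 0
  unimodal : StrictMonoOn (fun s : ℝ => dispersion α (s : Torus)) (Set.Icc 0 (1 / 2))

/-- `sin²(2πs) + 2 sin²(πs)`, as a function of a real variable. -/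
def scatteringReal (s : ℝ) : ℝ :=
  Real.sin (2 * Real.pi * s) ^ 2 + 2 * Real.sin (Real.pi * s) ^ 2

lemma scatteringReal_periodic : Function.Periodic scatteringReal 1 := by
  intro s
  have h1 : 2 * Real.pi * (s + 1) = 2 * Real.pi * s + 2 * Real.pi := by ring
  have h2 : Real.pi * (s + 1) = Real.pi * s + Real.pi := by ring
  simp only [scatteringReal, h1, h2, Real.sin_add_two_pi, Real.sin_add_pi, neg_sq]

/-- The total scattering kernel `R(k) = sin²(2πk) + 2 sin²(πk)` on the torus. -/
def scattering : Torus → ℝ := scatteringReal_periodic.lift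

/-- The kernel `r(k,k') = 4 sin(πk) sin(π(k-k')) sin(π(2k-k'))`, in real variables. -/
def scatteringAmplitude (k k' : ℝ) : ℝ :=
  4 * Real.sin (Real.pi * k) * Real.sin (Real.pi * (k - k')) * Real.sin (Real.pi * (2 * k - k'))

/-- The closed form of `R` agrees with `∫_𝕋 r²(k,k') dk'`. -/
lemma integral_scatteringAmplitude_sq (k : ℝ) :
    ∫ k' in (-(1 / 2) : ℝ)..(1 / 2), scatteringAmplitude k k' ^ 2 = scatteringReal k := by
  have key : ∀ k' : ℝ, HasDerivAt (fun x : ℝ => 4 * Real.sin (Real.pi * k) ^ 2 *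
      (x * (1 + Real.cos (2 * Real.pi * k) / 2)
        + Real.sin (2 * Real.pi * (k - x)) / (2 * Real.pi)
        + Real.sin (2 * Real.pi * (2 * k - x)) / (2 * Real.pi)
        - Real.sin (2 * Real.pi * (3 * k - 2 * x)) / (8 * Real.pi)))
      (scatteringAmplitude k k' ^ 2) k' := by
    intro k'
    have hs : ∀ a b c : ℝ, HasDerivAt (fun x : ℝ => Real.sin (2 * Real.pi * (a - b * x)) / c)
        (Real.cos (2 * Real.pi * (a - b * k')) * (2 * Real.pi * (-b)) / c) k' := by
      intro a b c
      have h0 : HasDerivAt (fun x : ℝ => 2 * Real.pi * (a - b * x)) (2 * Real.pi * (-b)) k' := by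
        simpa using (((hasDerivAt_id k').const_mul b).const_sub a).const_mul (2 * Real.pi)
      exact h0.sin.div_const c
    have h1 := hs k 1 (2 * Real.pi)
    have h2 := hs (2 * k) 1 (2 * Real.pi)
    have h3 := hs (3 * k) 2 (8 * Real.pi)
    simp only [one_mul] at h1 h2
    have h := (((((hasDerivAt_id k').mul_const (1 + Real.cos (2 * Real.pi * k) / 2)).add
      h1).add h2).sub h3).const_mul (4 * Real.sin (Real.pi * k) ^ 2)
    refine h.congr_deriv ?_
    symm
    have e1 : 2 * Real.pi * (k - k') = 2 * (Real.pi * (k - k')) := by ring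
    have e2 : 2 * Real.pi * (2 * k - k') = 2 * (Real.pi * (2 * k - k')) := by ring
    have e3 : 2 * Real.pi * (3 * k - 2 * k')
        = 2 * (Real.pi * (k - k')) + 2 * (Real.pi * (2 * k - k')) := by ring
    have e4 : 2 * Real.pi * k = 2 * (Real.pi * (2 * k - k')) - 2 * (Real.pi * (k - k')) := by ring
    have hpi := Real.pi_ne_zero
    rw [e3, e4, e1, e2, Real.cos_add, Real.cos_sub, scatteringAmplitude]
    generalize Real.pi * (k - k') = A
    generalize Real.pi * (2 * k - k') = B
    have hA : Real.sin A ^ 2 = 1 / 2 - Real.cos (2 * A) / 2 := Real.sin_sq_eq_half_sub A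
    have hB : Real.sin B ^ 2 = 1 / 2 - Real.cos (2 * B) / 2 := Real.sin_sq_eq_half_sub B
    rw [mul_pow, mul_pow, mul_pow, hA, hB]
    field_simp
    ring
  rw [intervalIntegral.integral_eq_sub_of_hasDerivAt (fun x _ => key x)
    (Continuous.intervalIntegrable (by unfold scatteringAmplitude; fun_prop) _ _)]
  have f1 : 2 * Real.pi * (k - 1 / 2) = 2 * Real.pi * k - Real.pi := by ring
  have f2 : 2 * Real.pi * (k - -(1 / 2)) = 2 * Real.pi * k + Real.pi := by ring
  have f3 : 2 * Real.pi * (2 * k - 1 / 2) = 2 * Real.pi * (2 * k) - Real.pi := by ring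
  have f4 : 2 * Real.pi * (2 * k - -(1 / 2)) = 2 * Real.pi * (2 * k) + Real.pi := by ring
  have f5 : 2 * Real.pi * (3 * k - 2 * (1 / 2)) = 2 * Real.pi * (3 * k) - 2 * Real.pi := by ring
  have f6 : 2 * Real.pi * (3 * k - 2 * -(1 / 2)) = 2 * Real.pi * (3 * k) + 2 * Real.pi := by ring
  have f7 : 2 * Real.pi * k = 2 * (Real.pi * k) := by ring
  simp only [f1, f2, f3, f4, f5, f6, Real.sin_sub_pi, Real.sin_add_pi, Real.sin_sub_two_pi,
    Real.sin_add_two_pi, scatteringReal]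
  rw [f7, Real.sin_two_mul, Real.cos_two_mul, mul_pow, mul_pow, Real.sin_sq]
  ring

/-- The matrix
`Ω_ε(k) = [[-γ₀ε R(k) - iω(k), γ₀ε R(k)], [γ₀ε R(k), -γ₀ε R(k) + iω(k)]]`. -/
def Omega (γ₀ : ℝ) (α : ℤ → ℝ) (ε : ℝ) (k : Torus) : Matrix (Fin 2) (Fin 2) ℂ :=
  !![-((γ₀ * ε * scattering k : ℝ) : ℂ) - Complex.I * (dispersion α k : ℂ),
      ((γ₀ * ε * scattering k : ℝ) : ℂ);
     ((γ₀ * ε * scattering k : ℝ) : ℂ),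
      -((γ₀ * ε * scattering k : ℝ) : ℂ) + Complex.I * (dispersion α k : ℂ)]

/-- The vector `𝔣 = (1, -1)`. -/
def fVec : Fin 2 → ℂ := ![1, -1]

/-- `j_ε(t,k) = ½ exp(Ω_ε(k) t) 𝔣 · 𝔣`. -/
def jEps (γ₀ : ℝ) (α : ℤ → ℝ) (ε t : ℝ) (k : Torus) : ℂ :=
  (1 / 2 : ℂ) * dotProduct (Matrix.mulVec (NormedSpace.exp ((t : ℂ) • Omega γ₀ α ε k)) fVec) fVec

/-- `J_ε(t) = ∫_𝕋 j_ε(t,k) dk`. -/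
def JEps (γ₀ : ℝ) (α : ℤ → ℝ) (ε t : ℝ) : ℂ := ∫ k : Torus, jEps γ₀ α ε t k

/-- `J(t) = ∫_𝕋 cos(ω(k) t) dk`. -/
def J (α : ℤ → ℝ) (t : ℝ) : ℝ := ∫ k : Torus, Real.cos (dispersion α k * t)

/-- The Laplace transform `∫_0^∞ exp(-z t) f(t) dt`. -/
def laplace (f : ℝ → ℂ) (z : ℂ) : ℂ :=
  ∫ t in Set.Ioi (0 : ℝ), Complex.exp (-z * (t : ℂ)) * f t

/-- `g̃(z) = (1 + γ₁ J̃(z))⁻¹`. -/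
def gTilde (γ₁ : ℝ) (α : ℤ → ℝ) (z : ℂ) : ℂ :=
  (1 + (γ₁ : ℂ) * laplace (fun t => (J α t : ℂ)) z)⁻¹

/-- `g̃_ε(z) = (1 + γ₁ J̃_ε(z))⁻¹`. -/
def gTildeEps (γ₀ γ₁ : ℝ) (α : ℤ → ℝ) (ε : ℝ) (z : ℂ) : ℂ :=
  (1 + (γ₁ : ℂ) * laplace (JEps γ₀ α ε) z)⁻¹

/-- The remainder `r̃_ε = (g̃_ε - g̃) / ε`. -/
def rTilde (γ₀ γ₁ : ℝ) (α : ℤ → ℝ) (ε : ℝ) (z : ℂ) : ℂ :=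
  (gTildeEps γ₀ γ₁ α ε z - gTilde γ₁ α z) / (ε : ℂ)

end HarmonicChain

end

/-! ### Damped oscillators and their Laplace transforms. -/

namespace HarmonicChain

/-! For fixed `k` the matrix flow is an oscillator with friction `a = γ₀ ε R(k)`, whose Laplace
transform is `z / (z² + 2az + ω²)`; `J` is the case `a = 0`. These resolvents have nonnegative real
part, and so have their torus averages. Hence both `g̃` functions are bounded by 1 and `w ↦ (1 + γ₁
w)⁻¹` is Lipschitz where it is used. Thus `ε r̃_ε` is bounded by 2, and dominated convergence
reduces the claim to showing, for almost every `k`, that the two averaged resolvents become equal at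
`ε K(k) - i ω(k)` as `ε → 0`.

This is `tendsto_averagedResolvent_sub`. Only momenta within order `ε` of the resonance `ω(k') =
ω(k)` matter. With `k' = s + ε y` the difference becomes an integral over `y` of order one, whose
limit integrand is a constant over a product of two linear functions of `y`. Their zeros lie in the
same half plane, so the integral vanishes (`integral_inv_mul_inv_eq_zero`). The integrable majorant
comes from `exists_linear_separation`: at a noncritical point of `ω²`, injectivity on the half
period forces `|ω²(x) - ω²(s)| ≥ c |x - s|`. Critical points are negligible because `ω²` is analytic
and not constant. -/

lemma sq_add_ne_zero_and_re_div_nonneg {z : ℂ} (hz : 0 < z.re) {a b : ℝ} (ha : 0 ≤ a)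
    (hb : 0 ≤ b) :
    z ^ 2 + 2 * a * z + b ≠ 0 ∧ 0 ≤ (z / (z ^ 2 + 2 * a * z + b)).re := by
  -- The sign of the real part of a quotient is that of the numerator times the conjugate
  -- denominator.
  have key : 0 < (z * (starRingEnd ℂ) (z ^ 2 + 2 * a * z + b)).re := by
    have : (z * (starRingEnd ℂ) (z ^ 2 + 2 * a * z + b)).re =
        (z.re ^ 2 + z.im ^ 2) * (z.re + 2 * a) + b * z.re := by
      simp [pow_two]
      ring
    rw [this]
    positivity
  refine ⟨fun h => by simp [h] at key, ?_⟩
  rw [div_eq_mul_inv, Complex.inv_def, ← mul_assoc, Complex.re_mul_ofReal]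
  exact mul_nonneg key.le (inv_nonneg.2 (Complex.normSq_nonneg _))

/-- The total energy of a damped linear oscillator does not grow. -/
lemma norm_sq_add_norm_sq_le {w v : ℝ → ℂ} {a ω : ℝ} (ha : 0 ≤ a)
    (hw : ∀ t, HasDerivAt w (-2 * a * w t - Complex.I * ω * v t) t)
    (hv : ∀ t, HasDerivAt v (-Complex.I * ω * w t) t) {t : ℝ} (ht : 0 ≤ t) :
    ‖w t‖ ^ 2 + ‖v t‖ ^ 2 ≤ ‖w 0‖ ^ 2 + ‖v 0‖ ^ 2 := by
  -- The exchange terms combine to the real part of `-iω` times a real number, which is zero; only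
  -- the friction remains.
  have hd : ∀ s, HasDerivAt (fun s => ‖w s‖ ^ 2 + ‖v s‖ ^ 2) (-4 * a * ‖w s‖ ^ 2) s := by
    intro s
    refine ((hw s).norm_sq.add (hv s).norm_sq).congr_deriv ?_
    rw [Complex.inner, Complex.inner, ← Complex.normSq_eq_norm_sq, Complex.normSq_apply]
    simp
    ring
  refine antitone_of_deriv_nonpos (fun s => (hd s).differentiableAt) (fun s => ?_) ht
  rw [(hd s).deriv]
  have := mul_nonneg ha (sq_nonneg ‖w s‖)
  linarith

lemma integrableOn_exp_neg_mul {z : ℂ} (hz : 0 < z.re) :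
    IntegrableOn (fun t : ℝ => Complex.exp (-z * t)) (Set.Ioi 0) := by
  have := integrableOn_exp_mul_complex_Ioi (a := -z) (by simpa using hz) 0
  simpa using this

lemma integrableOn_exp_mul_of_bounded {z : ℂ} (hz : 0 < z.re) {w : ℝ → ℂ} (hw : Continuous w)
    {M : ℝ} (hM : ∀ t, 0 ≤ t → ‖w t‖ ≤ M) :
    IntegrableOn (fun t : ℝ => Complex.exp (-z * t) * w t) (Set.Ioi 0) :=
  (integrableOn_exp_neg_mul hz).mul_bdd hw.aestronglyMeasurable
    ((ae_restrict_mem measurableSet_Ioi).mono fun t ht => hM t (le_of_lt ht))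

lemma laplace_of_damped_oscillator {w v : ℝ → ℂ} {a ω : ℝ} (ha : 0 ≤ a)
    (hw : ∀ t, HasDerivAt w (-2 * a * w t - Complex.I * ω * v t) t)
    (hv : ∀ t, HasDerivAt v (-Complex.I * ω * w t) t) (hw0 : w 0 = 1) (hv0 : v 0 = 0)
    {z : ℂ} (hz : 0 < z.re) :
    laplace w z = z / (z ^ 2 + 2 * a * z + (ω ^ 2 : ℝ)) := by
  have hD := (sq_add_ne_zero_and_re_div_nonneg hz ha (sq_nonneg ω)).1
  have hbound : ∀ t, 0 ≤ t → ‖w t‖ ≤ 1 ∧ ‖v t‖ ≤ 1 := by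
    intro t ht
    have h := norm_sq_add_norm_sq_le ha hw hv ht
    simp only [hw0, hv0, norm_one, norm_zero] at h
    exact ⟨(sq_le_one_iff₀ (norm_nonneg _)).1 (by nlinarith [sq_nonneg ‖v t‖]),
      (sq_le_one_iff₀ (norm_nonneg _)).1 (by nlinarith [sq_nonneg ‖w t‖])⟩
  set D := z ^ 2 + 2 * a * z + (ω ^ 2 : ℝ) with hDdef
  -- An explicit antiderivative of `exp(-zt) w(t)`: the coefficients of `w` and `v` are chosen so
  -- that the `v` terms cancel and `w` gets the factor `D / D`.
  set F : ℝ → ℂ := fun t => Complex.exp (-z * t) * (-z / D * w t + Complex.I * ω / D * v t) with hF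
  have hE : ∀ t : ℝ, HasDerivAt (fun t : ℝ => Complex.exp (-z * t))
      (Complex.exp (-z * t) * -z) t := by
    intro t
    have h : HasDerivAt (fun s : ℂ => Complex.exp (-z * s)) (Complex.exp (-z * t) * -z)
        (t : ℂ) := by
      simpa using ((hasDerivAt_id (t : ℂ)).const_mul (-z)).cexp
    exact h.comp_ofReal
  have hderiv : ∀ t : ℝ, HasDerivAt F (Complex.exp (-z * t) * w t) t := by
    intro t
    refine ((hE t).mul (((hw t).const_mul (-z / D)).add
      ((hv t).const_mul (Complex.I * ω / D)))).congr_deriv ?_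
    simp only [Pi.add_apply]
    field_simp
    rw [hDdef]
    push_cast
    ring_nf
    rw [Complex.I_sq]
    ring
  have hwc : Continuous w := continuous_iff_continuousAt.2 fun t => (hw t).continuousAt
  have hint := integrableOn_exp_mul_of_bounded hz hwc fun t ht => (hbound t ht).1
  have htend : Tendsto F atTop (𝓝 0) := by
    have h0 : Tendsto (fun t : ℝ => Real.exp (-z.re * t) * (‖-z / D‖ + ‖Complex.I * ω / D‖)) atTop
        (𝓝 0) := by
      have : Tendsto (fun t : ℝ => Real.exp (-z.re * t)) atTop (𝓝 0) :=
        Real.tendsto_exp_atBot.comp (tendsto_id.const_mul_atTop_of_neg (by linarith))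
      simpa using this.mul_const (‖-z / D‖ + ‖Complex.I * ω / D‖)
    refine squeeze_zero_norm' ?_ h0
    filter_upwards [eventually_ge_atTop 0] with t ht
    rw [hF, norm_mul, Complex.norm_exp]
    have : (-z * (t : ℂ)).re = -z.re * t := by simp
    rw [this]
    gcongr
    refine (norm_add_le _ _).trans ?_
    rw [norm_mul, norm_mul]
    gcongr
    · exact mul_le_of_le_one_right (norm_nonneg _) (hbound t ht).1
    · exact mul_le_of_le_one_right (norm_nonneg _) (hbound t ht).2
  rw [laplace, integral_Ioi_of_hasDerivAt_of_tendsto (hderiv 0).continuousAt.continuousWithinAt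
    (fun t _ => hderiv t) hint htend]
  simp [hF, hw0, hv0]
  ring

/-! ### The matrix flow as a damped oscillator. -/

section MatrixExponential

attribute [local instance] Matrix.linftyOpNormedRing Matrix.linftyOpNormedAlgebra

lemma continuous_matrix_exp : Continuous (NormedSpace.exp : Matrix (Fin 2) (Fin 2) ℂ → _) := by
  let _ : NormedAlgebra ℚ (Matrix (Fin 2) (Fin 2) ℂ) := NormedAlgebra.restrictScalars ℚ ℂ _
  exact NormedSpace.exp_continuous

lemma hasDerivAt_matrix_exp_mulVec (Ω : Matrix (Fin 2) (Fin 2) ℂ) (u : Fin 2 → ℂ) (t : ℝ) :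
    HasDerivAt (fun s : ℝ => (NormedSpace.exp ((s : ℂ) • Ω)).mulVec u)
      (Ω.mulVec ((NormedSpace.exp ((t : ℂ) • Ω)).mulVec u)) t := by
  have h : HasDerivAt (fun s : ℝ => NormedSpace.exp ((s : ℂ) • Ω))
      (Ω * NormedSpace.exp ((t : ℂ) • Ω)) t := by
    have h := (hasDerivAt_exp_smul_const' Ω (t : ℂ)).scomp t Complex.ofRealCLM.hasDerivAt
    simpa [Function.comp_def] using! h
  let Λ : Matrix (Fin 2) (Fin 2) ℂ →L[ℝ] (Fin 2 → ℂ) :=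
    LinearMap.toContinuousLinearMap
      { toFun := fun M => M.mulVec u
        map_add' := fun M N => Matrix.add_mulVec M N u
        map_smul' := fun c M => Matrix.smul_mulVec c M u }
  have := Λ.hasFDerivAt.comp_hasDerivAt t h
  rw [Matrix.mulVec_mulVec]
  exact this

end MatrixExponential

lemma jEps_eq (γ₀ : ℝ) (α : ℤ → ℝ) (ε t : ℝ) (k : Torus) :
    jEps γ₀ α ε t k = (1 / 2 : ℂ) *
      ((NormedSpace.exp ((t : ℂ) • Omega γ₀ α ε k)).mulVec fVec 0
        - (NormedSpace.exp ((t : ℂ) • Omega γ₀ α ε k)).mulVec fVec 1) := by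
  rw [jEps, dotProduct, Fin.sum_univ_two]
  simp [fVec]
  ring

/-- The half difference of the two components of the flow is `jEps`, and their half sum is the
companion. In these coordinates `Omega` puts friction `2 γ₀ ε R` on the difference, none on the sum,
and couples the two by `-iω`. -/
lemma exists_companion_jEps (γ₀ : ℝ) (α : ℤ → ℝ) (ε : ℝ) (k : Torus) :
    ∃ v : ℝ → ℂ,
      (∀ t, HasDerivAt (fun t => jEps γ₀ α ε t k)
        (-2 * ((γ₀ * ε * scattering k : ℝ) : ℂ) * jEps γ₀ α ε t k
          - Complex.I * dispersion α k * v t) t) ∧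
      (∀ t, HasDerivAt v (-Complex.I * dispersion α k * jEps γ₀ α ε t k) t) ∧
      jEps γ₀ α ε 0 k = 1 ∧ v 0 = 0 := by
  have hd := hasDerivAt_matrix_exp_mulVec (Omega γ₀ α ε k) fVec
  refine ⟨fun t => (1 / 2 : ℂ) *
      ((NormedSpace.exp ((t : ℂ) • Omega γ₀ α ε k)).mulVec fVec 0
        + (NormedSpace.exp ((t : ℂ) • Omega γ₀ α ε k)).mulVec fVec 1), ?_, ?_, ?_, ?_⟩
  · intro t
    have h := hasDerivAt_pi.1 (hd t)
    simp only [jEps_eq]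
    refine (((h 0).sub (h 1)).const_mul (1 / 2 : ℂ)).congr_deriv ?_
    generalize (NormedSpace.exp ((t : ℂ) • Omega γ₀ α ε k)).mulVec fVec = u
    simp [Omega, Matrix.mulVec, dotProduct, Fin.sum_univ_two]
    ring
  · intro t
    have h := hasDerivAt_pi.1 (hd t)
    simp only [jEps_eq]
    refine (((h 0).add (h 1)).const_mul (1 / 2 : ℂ)).congr_deriv ?_
    generalize (NormedSpace.exp ((t : ℂ) • Omega γ₀ α ε k)).mulVec fVec = u
    simp [Omega, Matrix.mulVec, dotProduct, Fin.sum_univ_two]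
    ring
  · rw [jEps_eq]
    simp [fVec, NormedSpace.exp_zero]
    norm_num
  · simp [fVec, NormedSpace.exp_zero]

/-! ### Averaging over the torus: Laplace transforms, positivity and bounds. -/

lemma continuous_scattering : Continuous scattering :=
  continuous_coinduced_dom.2 (by
    change Continuous scatteringReal
    unfold scatteringReal
    fun_prop)

lemma scattering_coe (s : ℝ) : scattering (s : Torus) = scatteringReal s := rfl

lemma scattering_nonneg (k : Torus) : 0 ≤ scattering k := by
  induction k using QuotientAddGroup.induction_on with
  | H s => exact (scattering_coe s).symm ▸ by unfold scatteringReal; positivity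

lemma scattering_le (k : Torus) : scattering k ≤ 3 := by
  induction k using QuotientAddGroup.induction_on with
  | H s =>
    change scatteringReal s ≤ 3
    have := Real.sin_sq_le_one (2 * Real.pi * s)
    have := Real.sin_sq_le_one (Real.pi * s)
    unfold scatteringReal
    linarith

lemma scatteringReal_neg (s : ℝ) : scatteringReal (-s) = scatteringReal s := by
  simp [scatteringReal]

/-- Exchange of the Laplace transform with the average over the torus. -/
lemma laplace_integral {f : ℝ → Torus → ℂ} (hf : Continuous (Function.uncurry f)) {M : ℝ}
    (hM : ∀ t k, 0 ≤ t → ‖f t k‖ ≤ M) {z : ℂ} (hz : 0 < z.re) :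
    laplace (fun t => ∫ k, f t k) z = ∫ k, laplace (fun t => f t k) z := by
  simp only [laplace, ← integral_const_mul]
  apply integral_integral_swap
  have h1 : Integrable (fun q : ℝ × Torus => Complex.exp (-z * (q.1 : ℂ)))
      ((volume.restrict (Set.Ioi 0)).prod volume) := by
    simpa using (integrableOn_exp_neg_mul hz).mul_prod
      (integrable_const (1 : ℂ) (μ := (volume : Measure Torus)))
  refine h1.mul_bdd (c := M) hf.aestronglyMeasurable ?_
  have : ∀ᵐ q ∂((volume.restrict (Set.Ioi (0 : ℝ))).prod (volume : Measure Torus)), 0 < q.1 :=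
    Measure.quasiMeasurePreserving_fst.ae (ae_restrict_mem measurableSet_Ioi)
  exact this.mono fun q hq => hM _ _ hq.le

/-- `∫_𝕋 z / (z² + 2 a(k) z + ω(k)²) dk`, the Laplace transform of the averaged oscillator. -/
noncomputable def averagedResolvent (a : Torus → ℝ) (α : ℤ → ℝ) (z : ℂ) : ℂ :=
  ∫ k : Torus, z / (z ^ 2 + 2 * (a k : ℂ) * z + (dispersion α k ^ 2 : ℝ))

variable {α : ℤ → ℝ} {γ₀ ε : ℝ} {z : ℂ}

lemma laplace_JEps (hω : Continuous (dispersion α)) (hγ₀ : 0 ≤ γ₀) (hε : 0 ≤ ε) (hz : 0 < z.re) :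
    laplace (JEps γ₀ α ε) z = averagedResolvent (fun k => γ₀ * ε * scattering k) α z := by
  have ha : ∀ k, 0 ≤ γ₀ * ε * scattering k := fun k =>
    mul_nonneg (mul_nonneg hγ₀ hε) (scattering_nonneg k)
  have hcont : Continuous (Function.uncurry (jEps γ₀ α ε)) := by
    have hΩ : Continuous (Omega γ₀ α ε) := by
      have := continuous_scattering
      refine continuous_matrix fun i j => ?_
      fin_cases i <;> fin_cases j <;> simp [Omega] <;> fun_prop
    have hexp : Continuous fun q : ℝ × Torus =>
        NormedSpace.exp ((q.1 : ℂ) • Omega γ₀ α ε q.2) :=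
      continuous_matrix_exp.comp
        ((Complex.continuous_ofReal.comp continuous_fst).smul (hΩ.comp continuous_snd))
    exact continuous_const.mul ((hexp.matrix_mulVec continuous_const).dotProduct continuous_const)
  have hb : ∀ t k, 0 ≤ t → ‖jEps γ₀ α ε t k‖ ≤ 1 := by
    intro t k ht
    obtain ⟨v, hw, hv, hw0, hv0⟩ := exists_companion_jEps γ₀ α ε k
    have h := norm_sq_add_norm_sq_le (ha k) hw hv ht
    simp only [hw0, hv0, norm_one, norm_zero] at h
    exact (sq_le_one_iff₀ (norm_nonneg _)).1 (by nlinarith [sq_nonneg ‖v t‖])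
  unfold JEps
  rw [laplace_integral hcont hb hz, averagedResolvent]
  refine integral_congr_ae (Eventually.of_forall fun k => ?_)
  obtain ⟨v, hw, hv, hw0, hv0⟩ := exists_companion_jEps γ₀ α ε k
  exact laplace_of_damped_oscillator (ha k) hw hv hw0 hv0 hz

lemma laplace_J (hω : Continuous (dispersion α)) (hz : 0 < z.re) :
    laplace (fun t => (J α t : ℂ)) z = averagedResolvent 0 α z := by
  have hJ : (fun t => (J α t : ℂ)) =
      fun t => ∫ k : Torus, ((Real.cos (dispersion α k * t) : ℝ) : ℂ) := by
    funext t
    rw [J, integral_complex_ofReal]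
  rw [hJ, laplace_integral (M := 1) (by unfold Function.uncurry; fun_prop)
    (fun t k _ => by rw [Complex.norm_real]; exact Real.abs_cos_le_one _) hz, averagedResolvent]
  refine integral_congr_ae (Eventually.of_forall fun k => ?_)
  -- The cosine is the frictionless oscillator, with companion `-i sin`.
  refine laplace_of_damped_oscillator (a := (0 : Torus → ℝ) k)
    (v := fun t => -Complex.I * (Real.sin (dispersion α k * t) : ℝ)) le_rfl
    (fun t => ?_) (fun t => ?_) (by simp) (by simp) hz
  · have h := (((hasDerivAt_id t).const_mul (dispersion α k)).cos).ofReal_comp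
    refine h.congr_deriv ?_
    simp
    ring_nf
    rw [Complex.I_sq]
    ring
  · have h := ((((hasDerivAt_id t).const_mul (dispersion α k)).sin).ofReal_comp).const_mul (-Complex.I)
    refine h.congr_deriv ?_
    simp
    ring

lemma continuous_averagedResolvent_integrand {a : Torus → ℝ} (hω : Continuous (dispersion α))
    (hac : Continuous a) (ha : ∀ k, 0 ≤ a k) (hz : 0 < z.re) :
    Continuous fun k : Torus => z / (z ^ 2 + 2 * (a k : ℂ) * z + (dispersion α k ^ 2 : ℝ)) := by
  refine Continuous.div continuous_const (by fun_prop) fun k => ?_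
  exact (sq_add_ne_zero_and_re_div_nonneg hz (ha k) (sq_nonneg _)).1

lemma re_averagedResolvent_nonneg {a : Torus → ℝ} (hω : Continuous (dispersion α))
    (hac : Continuous a) (ha : ∀ k, 0 ≤ a k) (hz : 0 < z.re) :
    0 ≤ (averagedResolvent a α z).re := by
  have hi : Integrable fun k : Torus =>
      z / (z ^ 2 + 2 * (a k : ℂ) * z + (dispersion α k ^ 2 : ℝ)) :=
    (continuous_averagedResolvent_integrand hω hac ha hz).integrable_of_hasCompactSupport
      (HasCompactSupport.of_compactSpace _)
  have := integral_re hi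
  simp only [RCLike.re_to_complex] at this
  rw [averagedResolvent, ← this]
  exact integral_nonneg fun k => (sq_add_ne_zero_and_re_div_nonneg hz (ha k) (sq_nonneg _)).2

lemma one_le_norm_one_add_mul {γ : ℝ} (hγ : 0 ≤ γ) {w : ℂ} (hw : 0 ≤ w.re) :
    1 ≤ ‖1 + (γ : ℂ) * w‖ := by
  have h : 1 ≤ (1 + (γ : ℂ) * w).re := by
    simp
    positivity
  exact h.trans (Complex.re_le_norm _)

/-- Both denominators have modulus at least 1, so the difference of the inverses is controlled by
its numerator. -/
lemma norm_inv_one_add_sub_inv_one_add_le {γ : ℝ} (hγ : 0 ≤ γ) {w v : ℂ} (hw : 0 ≤ w.re)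
    (hv : 0 ≤ v.re) :
    ‖(1 + (γ : ℂ) * w)⁻¹ - (1 + (γ : ℂ) * v)⁻¹‖ ≤ γ * ‖w - v‖ := by
  have h1 := one_le_norm_one_add_mul hγ hw
  have h2 := one_le_norm_one_add_mul hγ hv
  have n1 : 1 + (γ : ℂ) * w ≠ 0 := norm_pos_iff.1 (by linarith)
  have n2 : 1 + (γ : ℂ) * v ≠ 0 := norm_pos_iff.1 (by linarith)
  rw [inv_sub_inv n1 n2, norm_div, norm_mul]
  have e : 1 + (γ : ℂ) * v - (1 + (γ : ℂ) * w) = γ * (v - w) := by ring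
  rw [e, norm_mul, Complex.norm_real, Real.norm_of_nonneg hγ, norm_sub_rev]
  exact div_le_self (by positivity) (by nlinarith)

lemma norm_inv_one_add_le {γ : ℝ} (hγ : 0 ≤ γ) {w : ℂ} (hw : 0 ≤ w.re) :
    ‖(1 + (γ : ℂ) * w)⁻¹‖ ≤ 1 := by
  rw [norm_inv]
  exact inv_le_one_of_one_le₀ (one_le_norm_one_add_mul hγ hw)

end HarmonicChain

/-! ### Analyticity, symmetry and critical points of the squared dispersion relation. -/

namespace HarmonicChain

variable {α : ℤ → ℝ}

lemma summable_exp_neg_mul_abs_int {c : ℝ} (hc : 0 < c) :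
    Summable fun x : ℤ => Real.exp (-c * |(x : ℝ)|) := by
  have h : Summable fun n : ℕ => Real.exp (-c * |((n : ℤ) : ℝ)|) := by
    have := Real.summable_exp_nat_mul_iff.2 (neg_neg_of_pos hc)
    refine this.congr fun n => ?_
    simp [mul_comm]
  refine Summable.of_nat_of_neg h (h.congr fun n => ?_)
  simp

/-- The squared dispersion relation as a function on the line. -/
noncomputable def symbol (α : ℤ → ℝ) (s : ℝ) : ℝ := (fourierSeries α (s : Torus)).re

/-- Exponential decay of the coefficients makes the Fourier series holomorphic in a strip about the
real line. -/
lemma analyticOnNhd_symbol (hα : IsAdmissibleCoupling α) :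
    AnalyticOnNhd ℝ (symbol α) Set.univ := by
  obtain ⟨C, hC, hdecay⟩ := hα.exp_decay
  let F : ℂ → ℂ := fun w => ∑' x : ℤ, (α x : ℂ) *
    Complex.exp (2 * Real.pi * Complex.I * ((-x : ℤ) : ℂ) * w)
  -- In this strip the exponential grows at most like `exp(|x| / (2C))`, which uses up half of the
  -- decay rate `1 / C`.
  set δ : ℝ := 1 / (4 * Real.pi * C) with hδ
  have hδ0 : 0 < δ := by positivity
  let U : Set ℂ := {w | |w.im| < δ}
  have hU : IsOpen U := isOpen_lt (by fun_prop) continuous_const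
  have hsum : Summable fun x : ℤ => C * Real.exp (-(1 / (2 * C)) * |(x : ℝ)|) :=
    (summable_exp_neg_mul_abs_int (by positivity)).mul_left C
  have hF : DifferentiableOn ℂ F U := by
    refine Complex.differentiableOn_tsum_of_summable_norm hsum (fun x => ?_) hU fun x w hw => ?_
    · fun_prop
    · rw [norm_mul, Complex.norm_real, Complex.norm_exp]
      have hre : (2 * Real.pi * Complex.I * ((-x : ℤ) : ℂ) * w).re = 2 * Real.pi * (x * w.im) := by
        simp
        ring
      have hle : 2 * Real.pi * (x * w.im) ≤ 1 / (2 * C) * |(x : ℝ)| := by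
        have h1 : (x : ℝ) * w.im ≤ |(x : ℝ)| * δ := by
          refine (le_abs_self _).trans ?_
          rw [abs_mul]
          exact mul_le_mul_of_nonneg_left (le_of_lt hw) (abs_nonneg _)
        have h2 : 1 / (2 * C) * |(x : ℝ)| = 2 * Real.pi * (|(x : ℝ)| * δ) := by
          rw [hδ]
          field_simp
          ring
        rw [h2]
        exact mul_le_mul_of_nonneg_left h1 (by positivity)
      rw [hre]
      calc ‖α x‖ * Real.exp (2 * Real.pi * (x * w.im))
          ≤ (C * Real.exp (-|(x : ℝ)| / C)) * Real.exp (1 / (2 * C) * |(x : ℝ)|) := by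
            gcongr
            exact hdecay x
        _ = C * Real.exp (-(1 / (2 * C)) * |(x : ℝ)|) := by
            rw [mul_assoc, ← Real.exp_add]
            congr 2
            field_simp
            ring
  have hA : AnalyticOnNhd ℂ F (Complex.ofReal '' Set.univ) := by
    refine (hF.analyticOnNhd hU).mono ?_
    rintro _ ⟨s, -, rfl⟩
    simpa [U] using hδ0
  have he : symbol α = fun s : ℝ => (F s).re := by
    funext s
    simp only [symbol, fourierSeries, F, fourier_coe_apply, Complex.ofReal_one, div_one]
  rw [he]
  exact hA.re_ofReal

lemma continuous_symbol (hα : IsAdmissibleCoupling α) : Continuous (symbol α) :=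
  continuousOn_univ.1 (analyticOnNhd_symbol hα).continuousOn

lemma continuous_dispersion (hα : IsAdmissibleCoupling α) : Continuous (dispersion α) :=
  continuous_coinduced_dom.2 (Real.continuous_sqrt.comp (continuous_symbol hα))

/-- Away from the origin this is assumed; at the origin it follows by continuity. -/
lemma symbol_nonneg (hα : IsAdmissibleCoupling α) (s : ℝ) : 0 ≤ symbol α s := by
  by_cases hs : (s : Torus) = 0
  · have h0 : symbol α s = symbol α 0 := by simp [symbol, hs]
    rw [h0]
    refine ge_of_tendsto ((continuous_symbol hα).tendsto 0 |>.mono_left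
      (nhdsWithin_le_nhds (s := Set.Ioi 0))) ?_
    filter_upwards [Ioo_mem_nhdsGT (show (0 : ℝ) < 1 by norm_num)] with x hx
    refine (hα.pos x fun h => ?_).le
    obtain ⟨n, hn⟩ := (AddCircle.coe_eq_zero_iff 1).1 h
    simp only [zsmul_eq_mul, mul_one] at hn
    rw [← hn] at hx
    have h1 : 0 < n := by exact_mod_cast hx.1
    have h2 : n < 1 := by exact_mod_cast hx.2
    omega
  · exact (hα.pos _ hs).le

lemma dispersion_sq (hα : IsAdmissibleCoupling α) (s : ℝ) :
    dispersion α (s : Torus) ^ 2 = symbol α s :=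
  Real.sq_sqrt (symbol_nonneg hα s)

lemma symbol_neg (α : ℤ → ℝ) (s : ℝ) : symbol α (-s) = symbol α s := by
  have h : fourierSeries α ((-s : ℝ) : Torus) = (starRingEnd ℂ) (fourierSeries α (s : Torus)) := by
    rw [fourierSeries, fourierSeries, Complex.conj_tsum]
    refine tsum_congr fun x => ?_
    rw [map_mul, Complex.conj_ofReal, ← fourier_neg, fourier_coe_apply, fourier_coe_apply]
    push_cast
    ring_nf
  rw [symbol, h, Complex.conj_re, symbol]

lemma dispersion_neg (α : ℤ → ℝ) (s : ℝ) :
    dispersion α ((-s : ℝ) : Torus) = dispersion α (s : Torus) :=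
  congrArg Real.sqrt (symbol_neg α s)

lemma injOn_symbol (hα : IsAdmissibleCoupling α) : Set.InjOn (symbol α) (Set.Icc 0 (1 / 2)) := by
  intro s hs t ht h
  exact hα.unimodal.injOn hs ht (congrArg Real.sqrt h)

/-- The derivative is analytic and not identically zero, since the symbol is injective on the half
period; its zeros are therefore discrete. -/
lemma countable_critical_points (hα : IsAdmissibleCoupling α) :
    {s : ℝ | deriv (symbol α) s = 0}.Countable := by
  have hA := analyticOnNhd_symbol hα
  obtain ⟨x, hx⟩ : ∃ x, deriv (symbol α) x ≠ 0 := by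
    by_contra! h
    have hd : Differentiable ℝ (symbol α) := fun x => (hA x trivial).differentiableAt
    have h01 := is_const_of_deriv_eq_zero hd h 0 (1 / 2)
    have := injOn_symbol hα (by norm_num) (by norm_num) h01
    norm_num at this
  have h := (mem_codiscrete'.1 (hA.deriv.preimage_zero_mem_codiscrete hx)).2
  rw [← Set.preimage_compl, compl_compl] at h
  have : DiscreteTopology (deriv (symbol α) ⁻¹' {0} : Set ℝ) := h.to_subtype
  have hc : (deriv (symbol α) ⁻¹' {0}).Countable :=
    TopologicalSpace.separableSpace_iff_countable.1 inferInstance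
  exact hc.mono fun s hs => hs

lemma volume_singleton_torus (k : Torus) : volume ({k} : Set Torus) = 0 := by
  rw [← Metric.closedBall_zero, AddCircle.volume_closedBall]
  simp

/-- Almost every point of the torus has a dispersion value attained at a regular point of
`(0, 1/2)`. -/
lemma ae_exists_regular_point (hα : IsAdmissibleCoupling α) :
    ∀ᵐ k : Torus, ∃ s ∈ Set.Ioo (0 : ℝ) (1 / 2),
      deriv (symbol α) s ≠ 0 ∧ dispersion α k = dispersion α (s : Torus) := by
  let Z : Set ℝ := {s | deriv (symbol α) s = 0} ∪ {0, 1 / 2}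
  have hZ : Z.Countable := (countable_critical_points hα).union (by simp)
  -- Both signs are removed because a representative in `(-1/2, 0)` is reflected to the positive
  -- half period.
  let B : Set Torus := (fun s : ℝ => (s : Torus)) '' Z ∪ (fun s : ℝ => ((-s : ℝ) : Torus)) '' Z
  have hB : B.Countable := (hZ.image _).union (hZ.image _)
  have hB0 : volume B = 0 := by
    rw [← Set.biUnion_of_singleton B]
    exact (measure_biUnion_null_iff hB).2 fun k _ => volume_singleton_torus k
  filter_upwards [compl_mem_ae_iff.2 hB0] with k hk
  obtain ⟨s, hs, rfl⟩ : ∃ s ∈ Set.Ioc (-(1 / 2) : ℝ) (-(1 / 2) + 1), (s : Torus) = k := by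
    have := AddCircle.coe_image_Ioc_eq (1 : ℝ) (-(1 / 2) : ℝ)
    have hm : k ∈ (Set.univ : Set Torus) := trivial
    rw [← this] at hm
    exact hm
  have h1 : s ∉ Z := fun h => hk (Or.inl ⟨s, h, rfl⟩)
  have h2 : -s ∉ Z := fun h => hk (Or.inr ⟨-s, h, by simp⟩)
  simp only [Z, Set.mem_union, Set.mem_ofPred_eq, Set.mem_insert_iff, Set.mem_singleton_iff,
    not_or] at h1 h2
  rcases lt_or_gt_of_ne h1.2.1 with h | h
  · exact ⟨-s, ⟨by linarith, by linarith [hs.1]⟩, h2.1, (dispersion_neg α s).symm⟩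
  · exact ⟨s, ⟨h, lt_of_le_of_ne (by linarith [hs.2]) h1.2.2⟩, h1.1, rfl⟩

/-- At a regular point the symbol separates linearly on the whole half period. -/
lemma exists_linear_separation (hα : IsAdmissibleCoupling α) {s : ℝ}
    (hs : s ∈ Set.Ioo (0 : ℝ) (1 / 2)) (hd : deriv (symbol α) s ≠ 0) :
    ∃ c > 0, ∀ x ∈ Set.Icc (0 : ℝ) (1 / 2), c * |x - s| ≤ |symbol α x - symbol α s| := by
  have hdiff : DifferentiableAt ℝ (symbol α) s :=
    (analyticOnNhd_symbol hα s trivial).differentiableAt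
  have hsI : Set.Icc (0 : ℝ) (1 / 2) ∈ 𝓝 s := Icc_mem_nhds hs.1 hs.2
  -- The difference quotient, completed by the derivative at `s`, is continuous on a compact
  -- interval. It has no zero, by injectivity off `s` and regularity at `s`, so its minimum serves
  -- as `c`.
  have hcont : ContinuousOn (fun x => |dslope (symbol α) s x|) (Set.Icc 0 (1 / 2)) :=
    ((continuousOn_dslope hsI).2 ⟨(continuous_symbol hα).continuousOn, hdiff⟩).abs
  obtain ⟨y, hy, hmin⟩ := isCompact_Icc.exists_isMinOn ⟨s, Set.Ioo_subset_Icc_self hs⟩ hcont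
  have hne : ∀ x ∈ Set.Icc (0 : ℝ) (1 / 2), dslope (symbol α) s x ≠ 0 := by
    intro x hx h0
    by_cases hxs : x = s
    · rw [hxs, dslope_same] at h0
      exact hd h0
    · have := sub_smul_dslope (symbol α) s x
      rw [h0, smul_zero] at this
      exact hxs (injOn_symbol hα hx (Set.Ioo_subset_Icc_self hs) (sub_eq_zero.1 this.symm))
  refine ⟨_, abs_pos.2 (hne y hy), fun x hx => ?_⟩
  rw [← sub_smul_dslope (symbol α) s x, smul_eq_mul, abs_mul, mul_comm]
  exact mul_le_mul_of_nonneg_left (hmin hx) (abs_nonneg _)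

end HarmonicChain

/-! ### Blow-up around the resonance. -/

namespace HarmonicChain

/-- Supplies the integrable majorant: the constant bounds handle small `y`, the linear ones handle
large `y`. -/
lemma inv_mul_le_const_mul_inv_one_add_sq {p q u v y : ℝ} (hu : 0 < u) (hv : 0 < v)
    (hpu : u ≤ p) (hpv : v * |y| ≤ p) (hqu : u ≤ q) (hqv : v * |y| ≤ q) :
    (p * q)⁻¹ ≤ ((u ^ 2)⁻¹ + (v ^ 2)⁻¹) * (1 + y ^ 2)⁻¹ := by
  have hp : 0 < p := hu.trans_le hpu
  have hq : 0 < q := hu.trans_le hqu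
  have h1 : u ^ 2 ≤ p * q := by nlinarith
  have h2 : v ^ 2 * y ^ 2 ≤ p * q := by
    have := mul_le_mul hpv hqv (by positivity) hp.le
    calc v ^ 2 * y ^ 2 = v * |y| * (v * |y|) := by rw [← sq_abs y]; ring
      _ ≤ p * q := this
  have h3 : 1 ≤ (u ^ 2)⁻¹ * (p * q) := by
    rw [inv_mul_eq_div, le_div_iff₀ (by positivity)]
    linarith
  have h4 : y ^ 2 ≤ (v ^ 2)⁻¹ * (p * q) := by
    rw [inv_mul_eq_div, le_div_iff₀ (by positivity)]
    linarith
  rw [← div_eq_mul_inv, le_div_iff₀ (by positivity), inv_mul_le_iff₀ (by positivity)]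
  linarith

/-- Both poles lie in the same half plane, so the integral over the line vanishes. -/
lemma integral_inv_mul_inv_eq_zero {c b₁ b₂ : ℝ} (hc : c ≠ 0) (hb₁ : 0 < b₁) (hb₂ : 0 < b₂)
    (hb : b₁ ≠ b₂) :
    ∫ y : ℝ, (((c * y : ℝ) - Complex.I * b₁) * ((c * y : ℝ) - Complex.I * b₂) : ℂ)⁻¹ = 0 := by
  have hre : ∀ (b y : ℝ), |c * y| ≤ ‖((c * y : ℝ) - Complex.I * b : ℂ)‖ := fun b y => by
    simpa using Complex.abs_re_le_norm ((c * y : ℝ) - Complex.I * b : ℂ)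
  have him : ∀ (b y : ℝ), |b| ≤ ‖((c * y : ℝ) - Complex.I * b : ℂ)‖ := fun b y => by
    simpa using Complex.abs_im_le_norm ((c * y : ℝ) - Complex.I * b : ℂ)
  have hne : ∀ {b : ℝ}, 0 < b → ∀ y : ℝ, ((c * y : ℝ) - Complex.I * b : ℂ) ≠ 0 := fun hb y =>
    norm_pos_iff.1 ((abs_pos.2 hb.ne').trans_le (him _ y))
  have hcont : Continuous fun y : ℝ =>
      (((c * y : ℝ) - Complex.I * b₁) * ((c * y : ℝ) - Complex.I * b₂) : ℂ)⁻¹ :=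
    Continuous.inv₀ (by fun_prop) fun y => mul_ne_zero (hne hb₁ y) (hne hb₂ y)
  have hint : Integrable fun y : ℝ =>
      (((c * y : ℝ) - Complex.I * b₁) * ((c * y : ℝ) - Complex.I * b₂) : ℂ)⁻¹ := by
    refine (integrable_inv_one_add_sq.const_mul
      (((min b₁ b₂) ^ 2)⁻¹ + (|c| ^ 2)⁻¹)).mono' hcont.aestronglyMeasurable
      (Eventually.of_forall fun y => ?_)
    rw [norm_inv, norm_mul]
    refine inv_mul_le_const_mul_inv_one_add_sq (lt_min hb₁ hb₂) (abs_pos.2 hc) ?_ ?_ ?_ ?_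
    · exact (min_le_left _ _).trans ((le_abs_self _).trans (him _ _))
    · exact (abs_mul c y).symm.le.trans (hre _ _)
    · exact (min_le_right _ _).trans ((le_abs_self _).trans (him _ _))
    · exact (abs_mul c y).symm.le.trans (hre _ _)
  -- Up to a nonzero constant the integrand is the derivative of `log w`. Since `b₁` and `b₂` are
  -- both positive, `w` stays in the right half plane, so the principal branch applies; `w → 1` at
  -- both ends, so there is no net increment.
  let w : ℝ → ℂ := fun y => ((c * y : ℝ) - Complex.I * b₁) / ((c * y : ℝ) - Complex.I * b₂)
  have hslit : ∀ y, w y ∈ Complex.slitPlane := by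
    intro y
    left
    simp only [w, Complex.div_re]
    rw [← add_div]
    refine div_pos ?_ (Complex.normSq_pos.2 (hne hb₂ y))
    simp
    nlinarith [mul_pos hb₁ hb₂, mul_self_nonneg (c * y)]
  have hlin : ∀ (b y : ℝ), HasDerivAt (fun y : ℝ => ((c * y : ℝ) - Complex.I * b : ℂ)) c y := by
    intro b y
    have := (((hasDerivAt_id y).const_mul c).ofReal_comp).sub_const (Complex.I * b)
    simpa using this
  have hderiv : ∀ y, HasDerivAt (fun y => Complex.log (w y))
      (c * Complex.I * (b₁ - b₂) *
        (((c * y : ℝ) - Complex.I * b₁) * ((c * y : ℝ) - Complex.I * b₂) : ℂ)⁻¹) y := by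
    intro y
    have h1 := hne hb₁ y
    have h2 := hne hb₂ y
    refine (((hlin b₁ y).div (hlin b₂ y) h2).clog_real (hslit y)).congr_deriv ?_
    simp only [Pi.div_apply]
    field_simp
    ring
  have hw : ∀ l : Filter ℝ, Tendsto (fun y : ℝ => |y|) l atTop →
      Tendsto (fun y => Complex.log (w y)) l (𝓝 0) := by
    intro l hl
    have h1 : Tendsto w l (𝓝 1) := by
      have h0 : Tendsto (fun y : ℝ => Complex.I * (b₂ - b₁) * ((c * y : ℝ) - Complex.I * b₂ : ℂ)⁻¹)
          l (𝓝 0) := by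
        have : Tendsto (fun y : ℝ => ((c * y : ℝ) - Complex.I * b₂ : ℂ)⁻¹) l (𝓝 0) := by
          refine tendsto_inv₀_cobounded.comp (tendsto_norm_atTop_iff_cobounded.1 ?_)
          refine tendsto_atTop_mono (hre b₂) ?_
          simp only [abs_mul]
          exact hl.const_mul_atTop (abs_pos.2 hc)
        simpa using this.const_mul (Complex.I * (b₂ - b₁) : ℂ)
      have h2 : w = fun y => 1 + Complex.I * (b₂ - b₁) * ((c * y : ℝ) - Complex.I * b₂ : ℂ)⁻¹ := by
        funext y
        have := hne hb₂ y
        simp only [w]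
        field_simp
        ring
      rw [h2]
      simpa using h0.const_add 1
    have := h1.clog Complex.one_mem_slitPlane
    simpa using this
  have h := integral_of_hasDerivAt_of_tendsto hderiv (hint.const_mul _)
    (hw _ tendsto_abs_atBot_atTop) (hw _ tendsto_abs_atTop_atTop)
  rw [integral_const_mul, sub_zero] at h
  refine (mul_eq_zero.1 h).resolve_left ?_
  have hb' : (b₁ : ℂ) - b₂ ≠ 0 := sub_ne_zero.2 (by exact_mod_cast hb)
  have hc' : (c : ℂ) ≠ 0 := by exact_mod_cast hc
  exact mul_ne_zero (mul_ne_zero hc' Complex.I_ne_zero) hb'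

/-- An even function on the torus is integrated over half a period, blown up around `s`. -/
lemma integral_torus_eq_rescaled {f : Torus → ℂ} (hf : Continuous f)
    (heven : ∀ x : ℝ, f ((-x : ℝ) : Torus) = f (x : Torus)) (s : ℝ) {ε : ℝ} (hε : 0 < ε) :
    ∫ k, f k = 2 * ∫ y : ℝ,
      (ε : ℂ) * (Set.Icc (0 : ℝ) (1 / 2)).indicator (fun x : ℝ => f (x : Torus)) (s + ε * y) := by
  have hfc : Continuous fun x : ℝ => f (x : Torus) := hf.comp (AddCircle.continuous_mk' 1)
  have hi : ∀ a b : ℝ, IntervalIntegrable (fun x : ℝ => f (x : Torus)) volume a b :=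
    fun a b => hfc.intervalIntegrable a b
  have h1 : ∫ k, f k = 2 * ∫ x in (0 : ℝ)..(1 / 2), f (x : Torus) := by
    rw [← UnitAddCircle.intervalIntegral_preimage (-(1 / 2)) f,
      show (-(1 / 2) + 1 : ℝ) = 1 / 2 by norm_num,
      ← intervalIntegral.integral_add_adjacent_intervals (hi (-(1 / 2)) 0) (hi 0 (1 / 2))]
    have := intervalIntegral.integral_comp_neg (a := 0) (b := 1 / 2) fun x : ℝ => f (x : Torus)
    simp only [heven, neg_zero] at this
    rw [← this]
    ring
  rw [h1, intervalIntegral.integral_of_le (by norm_num), ← integral_Icc_eq_integral_Ioc,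
    ← integral_indicator measurableSet_Icc]
  set g := (Set.Icc (0 : ℝ) (1 / 2)).indicator fun x : ℝ => f (x : Torus)
  rw [integral_const_mul, Measure.integral_comp_mul_left (fun y => g (s + y)) ε,
    integral_add_left_eq_self g s, abs_of_pos (inv_pos.2 hε), Complex.real_smul]
  have : (ε : ℂ) ≠ 0 := by exact_mod_cast hε.ne'
  push_cast
  field_simp

variable {α : ℤ → ℝ} {γ₀ κ : ℝ}

lemma resolvent_denominator_eq {A ω a ε κ : ℝ} :
    ((ε * κ : ℝ) - Complex.I * ω : ℂ) ^ 2 + 2 * a * ((ε * κ : ℝ) - Complex.I * ω : ℂ) + A =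
      (A - ω ^ 2 + ε ^ 2 * κ ^ 2 + 2 * a * (ε * κ) : ℝ) -
        Complex.I * (2 * (ε * κ) * ω + 2 * a * ω : ℝ) := by
  push_cast
  ring_nf
  rw [Complex.I_sq]
  ring

/-- The denominator of the resolvent divided by `ε`. -/
noncomputable def scaledDenominator (A ω ρ κ ε : ℝ) : ℂ :=
  ((A - ω ^ 2) / ε + ε * κ ^ 2 + 2 * ρ * (ε * κ) : ℝ) - Complex.I * (2 * κ * ω + 2 * ρ * ω : ℝ)

lemma resolvent_denominator_eq_scaled {A ω ρ κ ε : ℝ} (hε : ε ≠ 0) :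
    ((ε * κ : ℝ) - Complex.I * ω : ℂ) ^ 2 +
        2 * (ε * ρ : ℝ) * ((ε * κ : ℝ) - Complex.I * ω : ℂ) + A =
      ε * scaledDenominator A ω ρ κ ε := by
  rw [resolvent_denominator_eq, scaledDenominator]
  have : (ε : ℂ) ≠ 0 := by exact_mod_cast hε
  push_cast
  field_simp

lemma le_norm_scaledDenominator {A ω ρ κ ε : ℝ} (hω : 0 < ω) (hκ : 0 < κ) (hρ : 0 ≤ ρ) :
    2 * κ * ω ≤ ‖scaledDenominator A ω ρ κ ε‖ := by
  have h := Complex.abs_im_le_norm (scaledDenominator A ω ρ κ ε)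
  have hi : (scaledDenominator A ω ρ κ ε).im = -(2 * κ * ω + 2 * ρ * ω) := by
    rw [scaledDenominator, Complex.sub_im, Complex.ofReal_im, Complex.I_mul_im, Complex.ofReal_re,
      zero_sub]
  rw [hi, abs_neg, abs_of_nonneg (by positivity)] at h
  have : 0 ≤ ρ * ω := by positivity
  linarith

/-- The real part gives `c |y| ≤ N + M` with `N` the norm; the bound `N ≥ 2κω` from the imaginary
part absorbs `M` into a multiple of `N`. -/
lemma linear_le_norm_scaledDenominator {A ω ρ κ ε c y M : ℝ} (hω : 0 < ω) (hκ : 0 < κ)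
    (hρ : 0 ≤ ρ) (hρM : κ ^ 2 + 2 * ρ * κ ≤ M) (hε : 0 < ε) (hε1 : ε ≤ 1)
    (hA : c * |ε * y| ≤ |A - ω ^ 2|) :
    c / (1 + M / (2 * κ * ω)) * |y| ≤ ‖scaledDenominator A ω ρ κ ε‖ := by
  have hM : 0 ≤ M := le_trans (by positivity) hρM
  have h1 := le_norm_scaledDenominator (A := A) (ε := ε) hω hκ hρ
  have h := Complex.abs_re_le_norm (scaledDenominator A ω ρ κ ε)
  have hr : (scaledDenominator A ω ρ κ ε).re =
      (A - ω ^ 2) / ε + ε * (κ ^ 2 + 2 * ρ * κ) := by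
    rw [scaledDenominator, Complex.sub_re, Complex.ofReal_re, Complex.I_mul_re, Complex.ofReal_im]
    ring
  rw [hr] at h
  set N := ‖scaledDenominator A ω ρ κ ε‖
  have h2 : c * |y| ≤ |(A - ω ^ 2) / ε| := by
    rw [abs_div, abs_of_pos hε, le_div_iff₀ hε]
    rw [abs_mul, abs_of_pos hε] at hA
    linarith
  have h3 : |(A - ω ^ 2) / ε| ≤ N + M := by
    have h4 := abs_sub_abs_le_abs_sub ((A - ω ^ 2) / ε) (-(ε * (κ ^ 2 + 2 * ρ * κ)))
    rw [sub_neg_eq_add, abs_neg,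
      abs_of_nonneg (show 0 ≤ ε * (κ ^ 2 + 2 * ρ * κ) by positivity)] at h4
    have h5 : ε * (κ ^ 2 + 2 * ρ * κ) ≤ M :=
      (mul_le_of_le_one_left (by positivity) hε1).trans hρM
    linarith
  have h6 : M ≤ M / (2 * κ * ω) * N := by
    rw [div_mul_eq_mul_div, le_div_iff₀ (by positivity)]
    exact mul_le_mul_of_nonneg_left h1 hM
  rw [div_mul_eq_mul_div, div_le_iff₀ (by positivity)]
  linarith

/-- The powers of `ε` balance: one from the change of variables and one from the friction against
one from each denominator. -/
lemma resolvent_difference_eq_scaled {A ω ρ κ ε : ℝ} (hω : 0 < ω) (hκ : 0 < κ) (hρ : 0 ≤ ρ)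
    (hε : ε ≠ 0) {z : ℂ} (hz : z = (ε * κ : ℝ) - Complex.I * ω) :
    (ε : ℂ) * (z / (z ^ 2 + 2 * (ε * ρ : ℝ) * z + A) - z / (z ^ 2 + 2 * (0 : ℝ) * z + A)) =
      -2 * ρ * z ^ 2 *
        (scaledDenominator A ω ρ κ ε * scaledDenominator A ω 0 κ ε)⁻¹ := by
  have hq : scaledDenominator A ω ρ κ ε ≠ 0 := norm_pos_iff.1
    (lt_of_lt_of_le (by positivity) (le_norm_scaledDenominator hω hκ hρ))
  have hp : scaledDenominator A ω 0 κ ε ≠ 0 := norm_pos_iff.1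
    (lt_of_lt_of_le (by positivity) (le_norm_scaledDenominator hω hκ le_rfl))
  have h1 := resolvent_denominator_eq_scaled (A := A) (ω := ω) (ρ := ρ) (κ := κ) hε
  have h0 := resolvent_denominator_eq_scaled (A := A) (ω := ω) (ρ := 0) (κ := κ) hε
  rw [← hz] at h1 h0
  rw [mul_zero] at h0
  have hdiff : (ε : ℂ) * scaledDenominator A ω 0 κ ε - ε * scaledDenominator A ω ρ κ ε =
      -(2 * ε * ρ * z) := by
    rw [← h1, ← h0]
    push_cast
    ring
  have hεc : (ε : ℂ) ≠ 0 := by exact_mod_cast hε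
  rw [h1, h0]
  have hdiff' : scaledDenominator A ω 0 κ ε - scaledDenominator A ω ρ κ ε = -(2 * ρ * z) :=
    mul_left_cancel₀ hεc (by linear_combination hdiff)
  field_simp
  linear_combination z * hdiff'

/-- Along the rays `ε κ - i ω(s)` at a regular point `s`, scattering of order `ε` does not change
the averaged resolvent in the limit. -/
lemma tendsto_averagedResolvent_sub (hα : IsAdmissibleCoupling α) (hγ₀ : 0 ≤ γ₀) (hκ : 0 < κ)
    {s : ℝ} (hs : s ∈ Set.Ioo (0 : ℝ) (1 / 2)) (hd : deriv (symbol α) s ≠ 0) :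
    Tendsto (fun ε : ℝ =>
      averagedResolvent (fun k => γ₀ * ε * scattering k) α
          ((ε * κ : ℝ) - Complex.I * dispersion α (s : Torus)) -
        averagedResolvent 0 α ((ε * κ : ℝ) - Complex.I * dispersion α (s : Torus)))
      (𝓝[>] 0) (𝓝 0) := by
  set ω := dispersion α (s : Torus) with hωdef
  have hω : 0 < ω := by
    have h0 : dispersion α ((0 : ℝ) : Torus) < ω :=
      hα.unimodal (by norm_num) (Set.Ioo_subset_Icc_self hs) hs.1
    exact (Real.sqrt_nonneg _).trans_lt h0
  have hA0 : ω ^ 2 = symbol α s := dispersion_sq hα s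
  obtain ⟨c, hc, hsep⟩ := exists_linear_separation hα hs hd
  set β : ℝ → ℝ := fun x => γ₀ * scatteringReal x with hβ
  have hβ0 : ∀ x, 0 ≤ β x := fun x => mul_nonneg hγ₀ (scattering_nonneg (x : Torus))
  have hβ3 : ∀ x, β x ≤ 3 * γ₀ := fun x => by
    have := mul_le_mul_of_nonneg_left (scattering_le (x : Torus)) hγ₀
    rw [scattering_coe] at this
    simp only [hβ]
    linarith
  have hβc : Continuous β := by
    simp only [hβ]
    unfold scatteringReal
    fun_prop
  have hsc := continuous_symbol hα
  let z : ℝ → ℂ := fun ε => (ε * κ : ℝ) - Complex.I * ω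
  let I : Set ℝ := Set.Icc 0 (1 / 2)
  let H : ℝ → ℝ → ℂ := fun ε x => -2 * β x * z ε ^ 2 *
    (scaledDenominator (symbol α x) ω (β x) κ ε * scaledDenominator (symbol α x) ω 0 κ ε)⁻¹
  have hne : ∀ ε x ρ, 0 ≤ ρ → scaledDenominator (symbol α x) ω ρ κ ε ≠ 0 := fun ε x ρ hρ =>
    norm_pos_iff.1 (lt_of_lt_of_le (by positivity) (le_norm_scaledDenominator hω hκ hρ))
  have hrepr : ∀ ε : ℝ, 0 < ε →
      averagedResolvent (fun k => γ₀ * ε * scattering k) α (z ε) - averagedResolvent 0 α (z ε) =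
        2 * ∫ y : ℝ, I.indicator (H ε) (s + ε * y) := by
    intro ε hε
    have hz : 0 < (z ε).re := by
      simp [z]
      positivity
    have hcω := continuous_dispersion hα
    have hcR : Continuous fun k => γ₀ * ε * scattering k :=
      continuous_const.mul continuous_scattering
    have hc1 := continuous_averagedResolvent_integrand hcω hcR
      (fun k => mul_nonneg (mul_nonneg hγ₀ hε.le) (scattering_nonneg k)) hz
    have hc2 := continuous_averagedResolvent_integrand (a := 0) hcω continuous_zero
      (fun k => le_rfl) hz
    rw [averagedResolvent, averagedResolvent, ← integral_sub
      (hc1.integrable_of_hasCompactSupport (HasCompactSupport.of_compactSpace _))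
      (hc2.integrable_of_hasCompactSupport (HasCompactSupport.of_compactSpace _))]
    refine (integral_torus_eq_rescaled (hc1.sub hc2) ?_ s hε).trans ?_
    · intro x
      simp only [Pi.sub_apply, dispersion_neg, scattering_coe, scatteringReal_neg, Pi.zero_apply]
    · congr 2
      funext y
      by_cases hy : s + ε * y ∈ I
      · rw [Set.indicator_of_mem hy, Set.indicator_of_mem hy]
        have := resolvent_difference_eq_scaled (A := symbol α (s + ε * y)) hω hκ
          (hβ0 (s + ε * y)) hε.ne' (z := z ε) rfl
        simp only [H]
        rw [← this]
        simp only [Pi.sub_apply, dispersion_sq hα, scattering_coe, hβ, Pi.zero_apply]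
        rw [show γ₀ * ε * scatteringReal (s + ε * y) =
          ε * (γ₀ * scatteringReal (s + ε * y)) by ring]
      · rw [Set.indicator_of_notMem hy, Set.indicator_of_notMem hy, mul_zero]
  have hlim : Tendsto (fun ε : ℝ => ∫ y : ℝ, I.indicator (H ε) (s + ε * y)) (𝓝[>] 0)
      (𝓝 (∫ y : ℝ, -2 * β s * (-Complex.I * ω) ^ 2 *
        (((deriv (symbol α) s * y : ℝ) - Complex.I * (2 * κ * ω + 2 * β s * ω : ℝ)) *
          ((deriv (symbol α) s * y : ℝ) - Complex.I * (2 * κ * ω : ℝ)) : ℂ)⁻¹)) := by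
    set M := κ ^ 2 + 2 * (3 * γ₀) * κ with hM
    set u := 2 * κ * ω with hu
    set v := c / (1 + M / u) with hv
    have hu0 : 0 < u := by positivity
    have hv0 : 0 < v := by positivity
    have hsmall : ∀ᶠ ε : ℝ in 𝓝[>] 0, ε ∈ Set.Ioo (0 : ℝ) 1 :=
      Ioo_mem_nhdsGT one_pos
    -- In the prefactor, `3γ₀` bounds `β` because `R ≤ 3`, and `κ + ω` bounds `|z ε|` for `ε ≤ 1`.
    refine tendsto_integral_filter_of_dominated_convergence
      (fun y => 2 * (3 * γ₀) * (κ + ω) ^ 2 * (((u ^ 2)⁻¹ + (v ^ 2)⁻¹) * (1 + y ^ 2)⁻¹)) ?_ ?_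
      ((integrable_inv_one_add_sq.const_mul _).const_mul _) ?_
    · filter_upwards [hsmall] with ε hε
      have hHc : Continuous (H ε) := by
        refine Continuous.mul (by fun_prop) (Continuous.inv₀ ?_ fun x =>
          mul_ne_zero (hne ε x _ (hβ0 x)) (hne ε x _ le_rfl))
        unfold scaledDenominator
        fun_prop
      exact ((hHc.measurable.indicator measurableSet_Icc).comp
        (by fun_prop : Measurable fun y : ℝ => s + ε * y)).aestronglyMeasurable
    · filter_upwards [hsmall] with ε hε
      refine Eventually.of_forall fun y => ?_
      by_cases hy : s + ε * y ∈ I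
      · rw [Set.indicator_of_mem hy]
        have hsepy := hsep _ hy
        rw [add_sub_cancel_left, ← hA0] at hsepy
        have hMρ : ∀ ρ, ρ ≤ 3 * γ₀ → κ ^ 2 + 2 * ρ * κ ≤ M := fun ρ hρ => by
          rw [hM]
          gcongr
        simp only [H]
        rw [norm_mul, norm_inv, norm_mul (scaledDenominator _ _ _ _ _)]
        have hznorm : ‖z ε‖ ≤ κ + ω := by
          refine (norm_sub_le _ _).trans (add_le_add ?_ ?_)
          · rw [Complex.norm_real, Real.norm_of_nonneg (mul_nonneg hε.1.le hκ.le)]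
            exact mul_le_of_le_one_left hκ.le hε.2.le
          · rw [norm_mul, Complex.norm_I, one_mul, Complex.norm_real, Real.norm_of_nonneg hω.le]
        have hpre : ‖(-2 * β (s + ε * y) * z ε ^ 2 : ℂ)‖ ≤ 2 * (3 * γ₀) * (κ + ω) ^ 2 := by
          rw [norm_mul, norm_mul, norm_pow, norm_neg, Complex.norm_real,
            Real.norm_of_nonneg (hβ0 _), Complex.norm_ofNat]
          have := hβ3 (s + ε * y)
          gcongr
        refine mul_le_mul hpre (inv_mul_le_const_mul_inv_one_add_sq hu0 hv0
          (le_norm_scaledDenominator hω hκ (hβ0 _)) ?_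
          (le_norm_scaledDenominator hω hκ le_rfl) ?_) (by positivity) (by positivity)
        · exact linear_le_norm_scaledDenominator hω hκ (hβ0 _) (hMρ _ (hβ3 _)) hε.1 hε.2.le hsepy
        · exact linear_le_norm_scaledDenominator hω hκ le_rfl (hMρ _ (by positivity)) hε.1
            hε.2.le hsepy
      · rw [Set.indicator_of_notMem hy, norm_zero]
        positivity
    · refine Eventually.of_forall fun y => ?_
      have hid : Tendsto (fun ε : ℝ => ε) (𝓝[>] 0) (𝓝 0) :=
        tendsto_nhdsWithin_of_tendsto_nhds tendsto_id
      have hx : Tendsto (fun ε : ℝ => s + ε * y) (𝓝[>] 0) (𝓝 s) := by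
        simpa using (hid.mul_const y).const_add s
      have hβx : Tendsto (fun ε : ℝ => β (s + ε * y)) (𝓝[>] 0) (𝓝 (β s)) :=
        (hβc.tendsto s).comp hx
      have hquot : Tendsto (fun ε : ℝ => (symbol α (s + ε * y) - ω ^ 2) / ε) (𝓝[>] 0)
          (𝓝 (deriv (symbol α) s * y)) := by
        have hds : HasDerivAt (symbol α) (deriv (symbol α) s) (s + 0 * y) := by
          rw [zero_mul, add_zero]
          exact (analyticOnNhd_symbol hα s trivial).differentiableAt.hasDerivAt
        have hli : HasDerivAt (fun ε : ℝ => s + ε * y) y 0 := by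
          simpa using ((hasDerivAt_id (0 : ℝ)).mul_const y).const_add s
        have h := (hds.comp (0 : ℝ) hli).tendsto_slope_zero_right
        refine h.congr fun ε => ?_
        simp [hA0, div_eq_inv_mul]
      have hden : ∀ ρ : ℝ → ℝ, ∀ ρ₀, Tendsto ρ (𝓝[>] 0) (𝓝 ρ₀) →
          Tendsto (fun ε : ℝ => scaledDenominator (symbol α (s + ε * y)) ω (ρ ε) κ ε) (𝓝[>] 0)
            (𝓝 ((deriv (symbol α) s * y : ℝ) - Complex.I * (2 * κ * ω + 2 * ρ₀ * ω : ℝ))) := by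
        intro ρ ρ₀ hρ
        unfold scaledDenominator
        refine Tendsto.sub ?_ ?_
        · refine (Complex.continuous_ofReal.tendsto _).comp ?_
          have := (hquot.add (hid.mul_const (κ ^ 2))).add
            ((hρ.const_mul 2).mul (hid.mul_const κ))
          simpa using this
        · refine ((Complex.continuous_ofReal.tendsto _).comp ?_).const_mul _
          exact ((hρ.const_mul 2).mul_const ω).const_add _
      have h1 := hden _ _ hβx
      have h0 := hden (fun _ => 0) 0 tendsto_const_nhds
      simp only [mul_zero, zero_mul, add_zero] at h0
      have hzt : Tendsto z (𝓝[>] 0) (𝓝 (-Complex.I * ω)) := by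
        have := ((Complex.continuous_ofReal.tendsto _).comp (hid.mul_const κ)).sub_const
          (Complex.I * ω)
        simpa [z, Function.comp_def] using this
      have hlimne : ∀ b : ℝ, 0 < b → ((deriv (symbol α) s * y : ℝ) - Complex.I * b : ℂ) ≠ 0 := by
        intro b hb h
        have := congrArg Complex.im h
        simp at this
        exact hb.ne' this
      have hH : Tendsto (fun ε : ℝ => H ε (s + ε * y)) (𝓝[>] 0) (𝓝 _) :=
        ((((Complex.continuous_ofReal.tendsto _).comp hβx).const_mul (-2)).mul (hzt.pow 2)).mul
          ((h1.mul h0).inv₀ (mul_ne_zero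
            (hlimne _ (add_pos_of_pos_of_nonneg hu0 (by have := hβ0 s; positivity)))
            (hlimne _ hu0)))
      refine hH.congr' ?_
      -- As `s` is interior, for fixed `y` the cutoff is eventually inactive.
      filter_upwards [hx.eventually (Icc_mem_nhds hs.1 hs.2)] with ε hε
      exact (Set.indicator_of_mem (s := I) hε _).symm
  have hzero : (∫ y : ℝ, -2 * β s * (-Complex.I * ω) ^ 2 *
      (((deriv (symbol α) s * y : ℝ) - Complex.I * (2 * κ * ω + 2 * β s * ω : ℝ)) *
        ((deriv (symbol α) s * y : ℝ) - Complex.I * (2 * κ * ω : ℝ)) : ℂ)⁻¹) = 0 := by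
    rw [integral_const_mul]
    -- If `β s = 0` the two poles coincide, but then the prefactor vanishes.
    rcases (hβ0 s).eq_or_lt with h | h
    · simp [← h]
    · rw [integral_inv_mul_inv_eq_zero hd (by positivity) (by positivity), mul_zero]
      have : 0 < 2 * β s * ω := by positivity
      linarith
  rw [hzero] at hlim
  have hlim2 := hlim.const_mul 2
  rw [mul_zero] at hlim2
  refine hlim2.congr' ?_
  filter_upwards [self_mem_nhdsWithin] with ε hε
  exact (hrepr ε hε).symm

/-- The resolvent is a measurable function of a measurable spectral parameter. -/
lemma measurable_averagedResolvent {a : Torus → ℝ} (hω : Continuous (dispersion α))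
    (ha : Continuous a) {z : Torus → ℂ} (hz : Continuous z) :
    Measurable fun k => averagedResolvent a α (z k) := by
  unfold averagedResolvent
  refine (StronglyMeasurable.integral_prod_right (f := fun k k' : Torus =>
    z k / (z k ^ 2 + 2 * (a k' : ℂ) * z k + (dispersion α k' ^ 2 : ℝ))) ?_).measurable
  refine Measurable.stronglyMeasurable (Measurable.div ?_ ?_)
  · exact (hz.comp continuous_fst).measurable
  · refine Continuous.measurable ?_
    fun_prop

end HarmonicChain

/-! ### Conclusion by dominated convergence over the torus. -/

theorem proposition3p1
    (γ₀ γ₁ : ℝ) (hγ₀ : 0 < γ₀) (hγ₁ : 0 < γ₁)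
    (α : ℤ → ℝ) (hα : HarmonicChain.IsAdmissibleCoupling α)
    (K : HarmonicChain.Torus → ℝ) (hK_uc : UniformContinuous K)
    (hK_bdd : ∃ C : ℝ, ∀ k, K k ≤ C) (hK_pos : ∀ k, 0 < K k) (hK_inf : 0 < ⨅ k, K k) :
    (∀ ε : ℝ, 0 < ε → ∀ z : ℂ, 0 < z.re →
      HarmonicChain.gTildeEps γ₀ γ₁ α ε z =
        HarmonicChain.gTilde γ₁ α z + (ε : ℂ) * HarmonicChain.rTilde γ₀ γ₁ α ε z) ∧
    ∀ p : ℝ, 1 ≤ p →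
      (∀ ε : ℝ, 0 < ε → Integrable (fun k : HarmonicChain.Torus =>
        ‖HarmonicChain.rTilde γ₀ γ₁ α ε
          ((ε * K k : ℝ) - Complex.I * (HarmonicChain.dispersion α k : ℂ))‖ ^ p)) ∧
      Tendsto (fun ε : ℝ => ε ^ p * ∫ k : HarmonicChain.Torus,
        ‖HarmonicChain.rTilde γ₀ γ₁ α ε
          ((ε * K k : ℝ) - Complex.I * (HarmonicChain.dispersion α k : ℂ))‖ ^ p)
        (𝓝[>] 0) (𝓝 0) := by
  open HarmonicChain in
  refine ⟨fun ε hε z _ => ?_, fun p hp => ?_⟩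
  · have : (ε : ℂ) ≠ 0 := by exact_mod_cast hε.ne'
    rw [rTilde]
    field_simp
    ring
  have hp0 : 0 < p := by linarith
  have hcω := continuous_dispersion hα
  let z : ℝ → Torus → ℂ := fun ε k => (ε * K k : ℝ) - Complex.I * dispersion α k
  have hKc := hK_uc.continuous
  have hzc : ∀ ε, Continuous (z ε) := fun ε => by
    simp only [z]
    fun_prop
  have hz : ∀ ε, 0 < ε → ∀ k, 0 < (z ε k).re := fun ε hε k => by
    simp [z]
    exact mul_pos hε (hK_pos k)
  -- This is `ε r̃_ε` along the curve, so the factor `ε ^ p` in the claim is absorbed exactly.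
  let r : ℝ → Torus → ℂ := fun ε k =>
    (1 + γ₁ * averagedResolvent (fun k => γ₀ * ε * scattering k) α (z ε k))⁻¹ -
      (1 + γ₁ * averagedResolvent 0 α (z ε k))⁻¹
  have hac : ∀ ε, Continuous fun k => γ₀ * ε * scattering k := fun ε =>
    continuous_const.mul continuous_scattering
  have hr : ∀ ε, 0 < ε → ∀ k, rTilde γ₀ γ₁ α ε (z ε k) = r ε k / ε := by
    intro ε hε k
    rw [rTilde, gTildeEps, gTilde, laplace_JEps hcω hγ₀.le hε.le (hz ε hε k),
      laplace_J hcω (hz ε hε k)]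
  have hpos : ∀ ε, 0 < ε → ∀ k,
      0 ≤ (averagedResolvent (fun k => γ₀ * ε * scattering k) α (z ε k)).re ∧
        0 ≤ (averagedResolvent 0 α (z ε k)).re := fun ε hε k =>
    ⟨re_averagedResolvent_nonneg hcω (hac ε)
      (fun k => mul_nonneg (mul_nonneg hγ₀.le hε.le) (scattering_nonneg k)) (hz ε hε k),
      re_averagedResolvent_nonneg hcω continuous_zero (fun _ => le_rfl) (hz ε hε k)⟩
  have hrm : ∀ ε, Measurable (r ε) := fun ε =>
    (((measurable_averagedResolvent hcω (hac ε) (hzc ε)).const_mul _).const_add _).inv.sub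
      (((measurable_averagedResolvent hcω continuous_zero (hzc ε)).const_mul _).const_add _).inv
  have hrpm : ∀ ε, AEStronglyMeasurable (fun k => ‖r ε k‖ ^ p) volume := fun ε =>
    ((hrm ε).norm.pow_const p).aestronglyMeasurable
  have hrb : ∀ ε, 0 < ε → ∀ k, ‖‖r ε k‖ ^ p‖ ≤ 2 ^ p := by
    intro ε hε k
    rw [Real.norm_of_nonneg (by positivity)]
    refine Real.rpow_le_rpow (norm_nonneg _) ((norm_sub_le _ _).trans ?_) hp0.le
    have h1 := norm_inv_one_add_le hγ₁.le (hpos ε hε k).1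
    have h2 := norm_inv_one_add_le hγ₁.le (hpos ε hε k).2
    linarith
  have hscale : ∀ ε, 0 < ε → ∀ k,
      ‖rTilde γ₀ γ₁ α ε (z ε k)‖ ^ p = (ε ^ p)⁻¹ * ‖r ε k‖ ^ p := by
    intro ε hε k
    rw [hr ε hε, norm_div, Complex.norm_real, Real.norm_of_nonneg hε.le,
      Real.div_rpow (norm_nonneg _) hε.le, div_eq_inv_mul]
  refine ⟨fun ε hε => ?_, ?_⟩
  · have hi : Integrable (fun k => ‖r ε k‖ ^ p) volume :=
      Integrable.of_bound (hrpm ε) (2 ^ p) (Eventually.of_forall (hrb ε hε))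
    exact (hi.const_mul (ε ^ p)⁻¹).congr
      (Eventually.of_forall fun k => (hscale ε hε k).symm)
  have hlim : Tendsto (fun ε : ℝ => ∫ k, ‖r ε k‖ ^ p) (𝓝[>] 0) (𝓝 (∫ _ : Torus, (0 : ℝ))) := by
    refine tendsto_integral_filter_of_dominated_convergence (fun _ => 2 ^ p)
      (Eventually.of_forall hrpm) ?_ (integrable_const _) ?_
    · filter_upwards [self_mem_nhdsWithin] with ε hε
      exact Eventually.of_forall (hrb ε hε)
    · filter_upwards [ae_exists_regular_point hα] with k hk
      obtain ⟨s, hs, hd, hks⟩ := hk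
      -- With `k` fixed, `K k` acts as the constant `κ`, and `s` carries the same frequency as `k`.
      have h := (tendsto_averagedResolvent_sub hα hγ₀.le (hK_pos k) hs hd).norm.const_mul γ₁
      rw [norm_zero, mul_zero] at h
      have hr0 : Tendsto (fun ε => ‖r ε k‖) (𝓝[>] 0) (𝓝 0) := by
        refine squeeze_zero' (Eventually.of_forall fun ε => norm_nonneg _) ?_ h
        filter_upwards [self_mem_nhdsWithin] with ε hε
        rw [← hks]
        exact norm_inv_one_add_sub_inv_one_add_le hγ₁.le (hpos ε hε k).1 (hpos ε hε k).2
      have := hr0.rpow_const (p := p) (Or.inr hp0.le)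
      rwa [Real.zero_rpow hp0.ne'] at this
  rw [integral_zero] at hlim
  refine hlim.congr' ?_
  filter_upwards [self_mem_nhdsWithin] with ε hε
  have hε' : (0 : ℝ) < ε ^ p := Real.rpow_pos_of_pos hε p
  have : (fun k => ‖rTilde γ₀ γ₁ α ε (z ε k)‖ ^ p) = fun k => (ε ^ p)⁻¹ * ‖r ε k‖ ^ p :=
    funext (hscale ε hε)
  change _ = ε ^ p * ∫ k, ‖rTilde γ₀ γ₁ α ε (z ε k)‖ ^ p
  rw [this, integral_const_mul, mul_inv_cancel_left₀ hε'.ne']
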